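/- Let the Euler numbers $E_0,E_1,E_2,\dots$ be the integers defined by $E_0=1$ and $\sum_{0\le k\le n,\ 2\mid k}\binom nk E_{n-k}=0$ for all integers $n\ge 1$. All sums below are over triples $(i,j,k)$ of nonnegative integers with the stated sum. For every odd prime $p$, $$\sum_{i+j+k=p-3}E_iE_jE_k\equiv-2E_{p-3}\pmod p.$$ Moreover, for each integer $n\ge 0$ there is a unique integer $t(n)$ such that $$\sum_{i+j+k=p-1+2n}E_iE_jE_k\equiv t(n)\pmod p$$ for every odd prime $p>2n+1$. In particular, $t(0)=3$, $t(1)=-9$, $t(2)=68$ and $t(3)=-1068$. -/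

import Mathlib

/-- The Euler numbers `E_0, E_1, E_2, …`: `E_0 = 1` and, for `n ≥ 1`,
`E_n = - ∑ C(n, k) E_{n-k}`, the sum being over the even `k` with `1 ≤ k ≤ n`
(here the summation variable is `i = k - 1`). -/
def eulerNumber : ℕ → ℤ
  | 0 => 1
  | n + 1 => - ∑ i : Fin (n + 1),
      if Even (i.val + 1) then ((n + 1).choose (i.val + 1) : ℤ) * eulerNumber (n - i.val) else 0

theorem eulerNumber_zero : eulerNumber 0 = 1 := by
  rw [eulerNumber]

/-- The defining recurrence of the Euler numbers:
`∑ C(n, k) E_{n-k} = 0` for `n ≥ 1`, the sum being over the even `k` with `0 ≤ k ≤ n`. -/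
theorem sum_choose_mul_eulerNumber (n : ℕ) (hn : 0 < n) :
    ∑ k ∈ (Finset.range (n + 1)).filter Even, (n.choose k : ℤ) * eulerNumber (n - k) = 0 := by
  obtain ⟨m, rfl⟩ : ∃ m, n = m + 1 := ⟨n - 1, by omega⟩
  rw [Finset.sum_filter, Finset.sum_range_succ', Finset.sum_range]
  simp only [Even.zero, if_true, Nat.choose_zero_right, Nat.cast_one, one_mul, Nat.sub_zero,
    Nat.add_sub_add_right]
  rw [eulerNumber]
  ring

/-- The sum `∑ E_i E_j E_k` over all triples of natural numbers with `i + j + k = m`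
(first `i + l = m`, then `j + k = l`). -/
def eulerTripleSum (m : ℕ) : ℤ :=
  ∑ x ∈ Finset.HasAntidiagonal.antidiagonal m, ∑ y ∈ Finset.HasAntidiagonal.antidiagonal x.2,
    eulerNumber x.1 * eulerNumber y.1 * eulerNumber y.2

/-! Modulo an odd prime `p`, Euler numbers are signed power sums: `E_n = ∑ ε(b) b^n` over `ZMod p`,
with signs `ε` (`eulerNumber_cast`). Hence the triple sum of weight `m` is `∑ ε(b) ε(c) ε(d) h_m(b,
c, d)`, with `h_m` complete homogeneous (`eulerTripleSum_cast`). For distinct arguments `h_m` is the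
sum of `b^(m+2) / ((b-c)(b-d))` and its two analogues, so Fermat's little theorem makes `h_(m+p-1) -
h_m` vanish unless two arguments coincide. There `ε² = 1` removes a pair of signs, and what remains
is a single signed power sum. This gives `T(m+p-1) = T(m) + 2(m+1) E_m` for the triple sum `T` and
`m < p-1`, hence `t(n) = T(2n) + 2(2n+1) E_(2n)`. In degree `p-3` the same method applies to
`b^(p-1) = 1 - [b = 0]`; the extra terms supported at zero arguments vanish because `E_(p-2) = 0`.
-/

/-- The complete homogeneous symmetric polynomial of degree `m` in two variables. -/
def homogTwo {R : Type*} [CommRing R] (m : ℕ) (b c : R) : R :=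
  ∑ x ∈ Finset.HasAntidiagonal.antidiagonal m, b ^ x.1 * c ^ x.2

/-- The complete homogeneous symmetric polynomial of degree `m` in three variables. -/
def homogThree {R : Type*} [CommRing R] (m : ℕ) (b c d : R) : R :=
  ∑ x ∈ Finset.HasAntidiagonal.antidiagonal m, b ^ x.1 * homogTwo x.2 c d

section Homogeneous

variable {R : Type*} [CommRing R]

theorem homogTwo_zero (b c : R) : homogTwo 0 b c = 1 := by simp [homogTwo]

theorem homogThree_zero (b c d : R) : homogThree 0 b c d = 1 := by simp [homogThree, homogTwo]

theorem homogTwo_succ (m : ℕ) (b c : R) :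
    homogTwo (m + 1) b c = c ^ (m + 1) + b * homogTwo m b c := by
  simp [homogTwo, Finset.Nat.sum_antidiagonal_succ, Finset.mul_sum, pow_succ', mul_assoc]

theorem homogThree_succ (m : ℕ) (b c d : R) :
    homogThree (m + 1) b c d = homogTwo (m + 1) c d + b * homogThree m b c d := by
  simp [homogThree, Finset.Nat.sum_antidiagonal_succ, Finset.mul_sum, pow_succ', mul_assoc]

theorem sub_mul_homogTwo (m : ℕ) (b c : R) :
    (b - c) * homogTwo m b c = b ^ (m + 1) - c ^ (m + 1) := by
  induction m with
  | zero => simp [homogTwo_zero]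
  | succ m ih => rw [homogTwo_succ]; linear_combination b * ih

theorem homogTwo_self (m : ℕ) (b : R) : homogTwo m b b = (m + 1) * b ^ m := by
  induction m with
  | zero => simp [homogTwo_zero]
  | succ m ih => rw [homogTwo_succ, ih]; push_cast; ring

theorem two_mul_homogThree_self (m : ℕ) (b : R) :
    2 * homogThree m b b b = (m + 1) * (m + 2) * b ^ m := by
  induction m with
  | zero => simp [homogThree_zero]
  | succ m ih =>
    rw [homogThree_succ, homogTwo_self]; push_cast; linear_combination b * ih

theorem sub_mul_homogThree (m : ℕ) (b c d : R) :
    (b - c) * homogThree m b c d = homogTwo (m + 1) b d - homogTwo (m + 1) c d := by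
  induction m with
  | zero => simp [homogThree_zero, homogTwo_succ, homogTwo_zero]
  | succ m ih =>
    rw [homogThree_succ, homogTwo_succ (m + 1) b, homogTwo_succ (m + 1) c]
    linear_combination b * ih

/-- Companion of `sub_mul_homogThree` for the case `b = c ≠ d`, where `b - c` cannot be cancelled.
-/
theorem sub_mul_homogThree' (m : ℕ) (b c d : R) :
    (c - d) * homogThree m b c d = homogTwo (m + 1) b c - homogTwo (m + 1) b d := by
  induction m with
  | zero => simp [homogThree_zero, homogTwo_succ, homogTwo_zero]
  | succ m ih =>
    rw [homogThree_succ, homogTwo_succ (m + 1) b, homogTwo_succ (m + 1) b]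
    linear_combination b * ih + sub_mul_homogTwo (m + 1) c d

end Homogeneous

/-! ### Euler numbers modulo `p` as signed power sums -/

/-- The signs `ε` with `∑ ε b * b ^ n = E_n` in `ZMod p`. -/
def eulerSign (p : ℕ) [Fact p.Prime] (b : ZMod p) : ZMod p := (-1) ^ ((b - 1) / 2).val

section Prime

variable {p : ℕ} [Fact p.Prime]

theorem two_ne_zero_of_odd (hp : Odd p) : (2 : ZMod p) ≠ 0 := by
  have hp' : p.Prime := Fact.out
  intro h
  have h2 : ((2 : ℕ) : ZMod p) = 0 := by exact_mod_cast h
  rw [ZMod.natCast_eq_zero_iff] at h2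
  rw [(Nat.prime_dvd_prime_iff_eq hp' Nat.prime_two).1 h2] at hp
  exact absurd hp (by decide)

theorem eulerSign_mul_self (b : ZMod p) : eulerSign p b * eulerSign p b = 1 := by
  rw [eulerSign, ← mul_pow]; simp

/-- With `b = 2a` the signs are the parities of the representatives of `a - 1` and `a`. These
alternate except at the wrap-around `a = 0`, where `p - 1` and `0` are both even. -/
theorem eulerSign_add_eulerSign (hp : Odd p) (b : ZMod p) :
    eulerSign p (b - 1) + eulerSign p (b + 1) = if b = 0 then 2 else 0 := by
  have h2 := two_ne_zero_of_odd hp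
  obtain ⟨a, rfl⟩ : ∃ a, b = 2 * a := ⟨b / 2, by field_simp⟩
  have e1 : (2 * a - 1 - 1) / 2 = a - 1 := by field_simp; ring
  have e2 : (2 * a + 1 - 1) / 2 = a := by field_simp; ring
  rw [eulerSign, eulerSign, e1, e2]
  have hpp : 1 < p := (Fact.out : p.Prime).one_lt
  by_cases ha : a = 0
  · subst ha
    have : (0 - 1 : ZMod p).val = p - 1 := by
      obtain ⟨q, rfl⟩ : ∃ q, p = q + 1 := ⟨p - 1, by omega⟩
      rw [zero_sub, ZMod.val_neg_one]; rfl
    rw [this, Even.neg_one_pow (by obtain ⟨k, rfl⟩ := hp; simp)]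
    simp; norm_num
  · have hv : 1 ≤ a.val := Nat.one_le_iff_ne_zero.2 (by simpa using ha)
    have : (a - 1).val = a.val - 1 := by
      have h1 : (1 : ZMod p).val = 1 := ZMod.val_one p
      rw [ZMod.val_sub (by rw [h1]; exact hv), h1]
    obtain ⟨k, hk⟩ : ∃ k, a.val = k + 1 := ⟨a.val - 1, by omega⟩
    rw [this, hk]
    simp [ha, h2, pow_succ]

theorem add_one_pow_add_sub_one_pow {R : Type*} [CommRing R] (n : ℕ) (b : R) :
    (b + 1) ^ n + (b - 1) ^ n =
      2 * ∑ k ∈ (Finset.range (n + 1)).filter Even, (n.choose k : R) * b ^ (n - k) := by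
  rw [add_comm b 1, sub_eq_neg_add, add_pow, add_pow, ← Finset.sum_add_distrib,
    Finset.sum_filter, Finset.mul_sum]
  refine Finset.sum_congr rfl fun k _ => ?_
  split_ifs with h
  · rw [h.neg_one_pow]; ring
  · rw [(Nat.not_even_iff_odd.1 h).neg_one_pow]; ring

/-- The even part of the binomial expansion is half of `(b+1)^n + (b-1)^n`; shifting `b` moves the
`±1` onto the signs, whose sum is concentrated at `0`. This is the recurrence defining the Euler
numbers. -/
theorem sum_choose_mul_sum_eulerSign (hp : Odd p) (n : ℕ) :
    ∑ k ∈ (Finset.range (n + 1)).filter Even,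
      (n.choose k : ZMod p) * ∑ b, eulerSign p b * b ^ (n - k) = 0 ^ n := by
  have h2 := two_ne_zero_of_odd hp
  apply mul_left_cancel₀ h2
  calc _ = ∑ b, eulerSign p b * ((b + 1) ^ n + (b - 1) ^ n) := by
        simp_rw [add_one_pow_add_sub_one_pow, Finset.mul_sum]
        rw [Finset.sum_comm]
        refine Finset.sum_congr rfl fun b _ => Finset.sum_congr rfl fun k _ => by ring
    _ = ∑ b, eulerSign p (b - 1) * b ^ n + ∑ b, eulerSign p (b + 1) * b ^ n := by
        simp_rw [mul_add, Finset.sum_add_distrib]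
        congr 1
        · rw [← Equiv.sum_comp (Equiv.addRight (1 : ZMod p)) fun b => eulerSign p (b - 1) * b ^ n]
          simp
        · rw [← Equiv.sum_comp (Equiv.subRight (1 : ZMod p)) fun b => eulerSign p (b + 1) * b ^ n]
          simp
    _ = ∑ b : ZMod p, (if b = 0 then 2 else 0) * b ^ n := by
        rw [← Finset.sum_add_distrib]
        simp_rw [← add_mul, eulerSign_add_eulerSign hp]
    _ = 2 * 0 ^ n := by simp

theorem eulerNumber_cast (hp : Odd p) (n : ℕ) :
    (eulerNumber n : ZMod p) = ∑ b, eulerSign p b * b ^ n := by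
  induction n using Nat.strong_induction_on with
  | _ n ih =>
    have h := sum_choose_mul_sum_eulerSign hp n
    rcases Nat.eq_zero_or_pos n with rfl | hn
    · simpa [Finset.sum_filter, eulerNumber_zero] using h.symm
    · have h' := congrArg (Int.cast : ℤ → ZMod p) (sum_choose_mul_eulerNumber n hn)
      push_cast at h'
      rw [zero_pow hn.ne', Finset.sum_filter, Finset.sum_range_succ'] at h
      rw [Finset.sum_filter, Finset.sum_range_succ'] at h'
      have : ∀ k ∈ Finset.range n,
          (if Even (k + 1) then (n.choose (k + 1) : ZMod p) * (eulerNumber (n - (k + 1)) : ZMod p)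
            else 0) =
          if Even (k + 1) then (n.choose (k + 1) : ZMod p) *
            ∑ b, eulerSign p b * b ^ (n - (k + 1)) else 0 := by
        intro k hk
        rw [ih (n - (k + 1)) (by have := Finset.mem_range.1 hk; omega)]
      rw [Finset.sum_congr rfl this] at h'
      simp only [Even.zero, if_true, Nat.choose_zero_right, Nat.cast_one, one_mul,
        Nat.sub_zero] at h h'
      linear_combination h' - h

theorem eulerNumber_of_odd (n : ℕ) (hn : Odd n) : eulerNumber n = 0 := by
  induction n using Nat.strong_induction_on with
  | _ n ih =>
    have h := sum_choose_mul_eulerNumber n hn.pos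
    rw [Finset.sum_filter, Finset.sum_range_succ', Finset.sum_eq_zero] at h
    · simpa using h
    · intro k hk
      split_ifs with he
      · have hk' := Finset.mem_range.1 hk
        rw [ih (n - (k + 1)) (by omega) (Nat.Odd.sub_even (by omega) hn he), mul_zero]
      · rfl

/-! ### Convolutions of Euler numbers as signed sums of homogeneous polynomials -/

theorem sum_sum_sum_comm {ι R : Type*} [CommRing R] (s : Finset ι) (F : ZMod p → ZMod p → ι → R) :
    ∑ b, ∑ c, ∑ x ∈ s, F b c x = ∑ x ∈ s, ∑ b, ∑ c, F b c x := by
  rw [Finset.sum_comm (s := s)]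
  exact Finset.sum_congr rfl fun b _ => Finset.sum_comm

theorem sum_eulerNumber_mul_cast (hp : Odd p) (m : ℕ) :
    ∑ y ∈ Finset.HasAntidiagonal.antidiagonal m,
      (eulerNumber y.1 : ZMod p) * (eulerNumber y.2 : ZMod p) =
    ∑ c, ∑ d, eulerSign p c * eulerSign p d * homogTwo m c d := by
  simp_rw [homogTwo, Finset.mul_sum, sum_sum_sum_comm, eulerNumber_cast hp, Finset.sum_mul_sum]
  refine Finset.sum_congr rfl fun y _ => Finset.sum_congr rfl fun c _ =>
    Finset.sum_congr rfl fun d _ => by ring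

theorem eulerTripleSum_cast (hp : Odd p) (m : ℕ) :
    (eulerTripleSum m : ZMod p) = ∑ b, ∑ c, ∑ d,
      eulerSign p b * eulerSign p c * eulerSign p d * homogThree m b c d := by
  rw [eulerTripleSum]
  push_cast
  simp_rw [mul_assoc ((eulerNumber _ : ℤ) : ZMod p), ← Finset.mul_sum,
    sum_eulerNumber_mul_cast hp, homogThree, Finset.mul_sum, sum_sum_sum_comm]
  rw [Finset.sum_comm (s := Finset.univ)]
  refine Finset.sum_congr rfl fun x _ => ?_
  simp_rw [← Finset.mul_sum]
  rw [eulerNumber_cast hp, Finset.sum_mul]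
  refine Finset.sum_congr rfl fun b _ => ?_
  simp_rw [Finset.mul_sum]
  refine Finset.sum_congr rfl fun c _ => Finset.sum_congr rfl fun d _ => by ring

/-! ### Sums of rational functions over `ZMod p` -/

theorem sum_inv_eq_zero (hp : Odd p) : ∑ b : ZMod p, b⁻¹ = 0 := by
  have h2 := two_ne_zero_of_odd hp
  have h : ∑ b : ZMod p, b⁻¹ = -∑ b : ZMod p, b⁻¹ := by
    rw [← Finset.sum_neg_distrib, ← Equiv.sum_comp (Equiv.neg (ZMod p))]
    simp [inv_neg]
  apply mul_left_cancel₀ h2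
  linear_combination h

theorem sum_inv_sub_eq_zero (hp : Odd p) (c : ZMod p) : ∑ b : ZMod p, (b - c)⁻¹ = 0 := by
  rw [← sum_inv_eq_zero hp, ← Equiv.sum_comp (Equiv.subRight c) fun b : ZMod p => b⁻¹]
  simp

theorem sum_inv_sq_eq_zero (hp : 3 < p) : ∑ b : ZMod p, (b ^ 2)⁻¹ = 0 := by
  have := FiniteField.sum_pow_lt_card_sub_one (ZMod p) 2 (by rw [ZMod.card]; omega)
  rw [← this, ← Equiv.sum_comp (Equiv.inv (ZMod p)) fun b : ZMod p => b ^ 2]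
  simp

theorem sum_homogTwo_eq_zero {m : ℕ} (hm : m < p - 1) (c : ZMod p) :
    ∑ b : ZMod p, homogTwo m b c = 0 := by
  simp_rw [homogTwo]
  rw [Finset.sum_comm]
  refine Finset.sum_eq_zero fun x hx => ?_
  rw [← Finset.sum_mul, FiniteField.sum_pow_lt_card_sub_one, zero_mul]
  rw [ZMod.card]
  have := Finset.HasAntidiagonal.mem_antidiagonal.1 hx
  omega

theorem sum_pow_succ_div_sub (hp : Odd p) {m : ℕ} (hm : m < p - 1) (c : ZMod p) :
    ∑ b : ZMod p, b ^ (m + 1) / (b - c) = -((m + 1) * c ^ m) := by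
  -- At `b = c` the quotient is `0` by convention while `homogTwo m c c = (m + 1) * c ^ m`; this
  -- term alone survives summation.
  have h : ∀ b : ZMod p, b ^ (m + 1) / (b - c) = c ^ (m + 1) * (b - c)⁻¹ + homogTwo m b c -
      if b = c then (m + 1) * c ^ m else 0 := by
    intro b
    split_ifs with hb
    · subst hb; simp [homogTwo_self]
    · have := sub_ne_zero.2 hb
      have h1 := sub_mul_homogTwo m b c
      field_simp
      linear_combination -h1
  simp_rw [h, Finset.sum_sub_distrib, Finset.sum_add_distrib, ← Finset.mul_sum,
    sum_inv_sub_eq_zero hp, sum_homogTwo_eq_zero hm]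
  simp

/-! ### Raising the degree by `p - 1` -/

theorem pow_add_card_sub_one {k : ℕ} (hk : 0 < k) (b : ZMod p) : b ^ (k + (p - 1)) = b ^ k := by
  by_cases hb : b = 0
  · subst hb; rw [zero_pow (by omega), zero_pow (by omega)]
  · rw [pow_add, ZMod.pow_card_sub_one_eq_one hb, mul_one]

theorem cast_card_sub_one : ((p - 1 : ℕ) : ZMod p) = -1 := by
  rw [Nat.cast_sub (Fact.out : p.Prime).one_lt.le]; simp

theorem homogTwo_add_card_sub_one (m : ℕ) (b c : ZMod p) :
    homogTwo (m + 1 + (p - 1)) b c =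
      homogTwo (m + 1) b c - if b = c then b ^ (m + 1) else 0 := by
  split_ifs with h
  · subst h
    rw [homogTwo_self, homogTwo_self, pow_add_card_sub_one (by omega), Nat.cast_add,
      cast_card_sub_one]
    ring
  · apply mul_left_cancel₀ (sub_ne_zero.2 h)
    have e : m + 1 + (p - 1) + 1 = m + 1 + 1 + (p - 1) := by ring
    rw [sub_zero, sub_mul_homogTwo, sub_mul_homogTwo, e, pow_add_card_sub_one (by omega),
      pow_add_card_sub_one (by omega)]

theorem homogThree_add_card_sub_one (hp : Odd p) (m : ℕ) (b c d : ZMod p) :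
    homogThree (m + (p - 1)) b c d = homogThree m b c d
      - (if b = c then if c = d then (m + 1) * b ^ m else 0 else 0)
      - (if b = c then b ^ (m + 1) / (b - d) else 0)
      - (if d = b then d ^ (m + 1) / (d - c) else 0)
      - (if c = d then c ^ (m + 1) / (c - b) else 0) := by
  have h2 := two_ne_zero_of_odd hp
  have e : m + (p - 1) + 1 = m + 1 + (p - 1) := by ring
  have h3 := sub_mul_homogThree m b c d
  have h3' := sub_mul_homogThree' m b c d
  have h4 := sub_mul_homogThree (m + (p - 1)) b c d
  have h4' := sub_mul_homogThree' (m + (p - 1)) b c d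
  rw [e, homogTwo_add_card_sub_one, homogTwo_add_card_sub_one] at h4 h4'
  by_cases hbc : b = c
  · subst hbc
    by_cases hbd : b = d
    · subst hbd
      have h5 := two_mul_homogThree_self (m + (p - 1)) b
      have h6 := two_mul_homogThree_self m b
      apply mul_left_cancel₀ h2
      rw [h5]
      simp only [if_true, sub_self, div_zero, sub_zero, mul_sub, h6]
      rw [Nat.cast_add, cast_card_sub_one]
      -- Both sides carry the factor `m`, which covers `m = 0`, where Fermat fails for `b = 0`.
      rcases Nat.eq_zero_or_pos m with rfl | hm
      · simp
      · rw [pow_add_card_sub_one hm]; ring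
    · have hbd' := sub_ne_zero.2 hbd
      have hdb : ¬ d = b := fun h => hbd h.symm
      apply mul_left_cancel₀ hbd'
      rw [h4']
      simp only [hbd, hdb, if_true, if_false, sub_zero, mul_sub, h3']
      field_simp
      ring
  · have hbc' := sub_ne_zero.2 hbc
    have hcb' := sub_ne_zero.2 (Ne.symm hbc)
    apply mul_left_cancel₀ hbc'
    rw [h4]
    simp only [hbc, if_false, sub_zero, mul_sub, h3]
    by_cases hbd : b = d
    · subst hbd
      have : ¬ c = b := fun h => hbc h.symm
      simp only [this, if_true, if_false, mul_zero, sub_zero]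
      field_simp
      ring
    · have hdb : ¬ d = b := fun h => hbd h.symm
      by_cases hcd : c = d
      · subst hcd
        simp only [hbd, hdb, if_true, if_false, mul_zero, sub_zero]
        field_simp
        ring
      · simp [hbd, hdb, hcd]

/-! ### Collapsing diagonal terms -/

theorem sum_triple_diagonal (ε f : ZMod p → ZMod p) (hε : ∀ b, ε b * ε b = 1) :
    ∑ b, ∑ c, ∑ d, ε b * ε c * ε d * (if b = c then if c = d then f b else 0 else 0) =
      ∑ b, ε b * f b := by
  refine Finset.sum_congr rfl fun b _ => ?_
  rw [Finset.sum_eq_single b (by intro c _ hc; simp [hc.symm]) (by simp)]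
  simp [hε]

theorem sum_triple_eq_fst_snd (ε : ZMod p → ZMod p) (f : ZMod p → ZMod p → ZMod p)
    (hε : ∀ b, ε b * ε b = 1) :
    ∑ b, ∑ c, ∑ d, ε b * ε c * ε d * (if b = c then f b d else 0) =
      ∑ d, ε d * ∑ b, f b d := by
  simp_rw [Finset.mul_sum]
  rw [Finset.sum_comm (s := Finset.univ) (t := Finset.univ) (f := fun d b => ε d * f b d)]
  refine Finset.sum_congr rfl fun b _ => ?_
  rw [Finset.sum_eq_single b (by intro c _ hc; simp [hc.symm]) (by simp)]
  simp [hε]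

theorem sum_triple_rotate (F : ZMod p → ZMod p → ZMod p → ZMod p) :
    ∑ b, ∑ c, ∑ d, F b c d = ∑ b, ∑ c, ∑ d, F d b c := by
  rw [Finset.sum_comm]
  simp_rw [Finset.sum_comm (s := Finset.univ) (t := Finset.univ) (f := fun b d => F b _ d)]

theorem sum_triple_eq_snd_thd (ε : ZMod p → ZMod p) (f : ZMod p → ZMod p → ZMod p)
    (hε : ∀ b, ε b * ε b = 1) :
    ∑ b, ∑ c, ∑ d, ε b * ε c * ε d * (if c = d then f c b else 0) =
      ∑ d, ε d * ∑ b, f b d := by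
  rw [← sum_triple_eq_fst_snd ε f hε, sum_triple_rotate]
  refine Finset.sum_congr rfl fun b _ => Finset.sum_congr rfl fun c _ =>
    Finset.sum_congr rfl fun d _ => by ring

theorem sum_triple_eq_thd_fst (ε : ZMod p → ZMod p) (f : ZMod p → ZMod p → ZMod p)
    (hε : ∀ b, ε b * ε b = 1) :
    ∑ b, ∑ c, ∑ d, ε b * ε c * ε d * (if d = b then f d c else 0) =
      ∑ d, ε d * ∑ b, f b d := by
  rw [← sum_triple_eq_snd_thd ε f hε, sum_triple_rotate]
  refine Finset.sum_congr rfl fun b _ => Finset.sum_congr rfl fun c _ =>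
    Finset.sum_congr rfl fun d _ => by ring

/-- The full diagonal contributes `-(m+1) E_m`, and each of the three partial diagonals `+(m+1)
E_m`. -/
theorem eulerTripleSum_add_card_sub_one (hp : Odd p) {m : ℕ} (hm : m < p - 1) :
    (eulerTripleSum (m + (p - 1)) : ZMod p) =
      eulerTripleSum m + 2 * (m + 1) * eulerNumber m := by
  simp_rw [eulerTripleSum_cast hp, homogThree_add_card_sub_one hp, mul_sub,
    Finset.sum_sub_distrib]
  rw [sum_triple_diagonal (eulerSign p) (fun b => ((m : ZMod p) + 1) * b ^ m) eulerSign_mul_self,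
    sum_triple_eq_fst_snd (eulerSign p) (fun b d => b ^ (m + 1) / (b - d)) eulerSign_mul_self,
    sum_triple_eq_thd_fst (eulerSign p) (fun b d => b ^ (m + 1) / (b - d)) eulerSign_mul_self,
    sum_triple_eq_snd_thd (eulerSign p) (fun b d => b ^ (m + 1) / (b - d)) eulerSign_mul_self]
  simp_rw [sum_pow_succ_div_sub hp hm]
  have h : ∑ b : ZMod p, eulerSign p b * (((m : ZMod p) + 1) * b ^ m) =
      (m + 1) * eulerNumber m := by
    rw [eulerNumber_cast hp, Finset.mul_sum]
    exact Finset.sum_congr rfl fun b _ => by ring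
  simp_rw [mul_neg, Finset.sum_neg_distrib, h]
  ring

/-! ### Degree `p - 3` -/

theorem pow_card_sub_one_eq_ite (b : ZMod p) : b ^ (p - 1) = if b = 0 then 0 else 1 := by
  have := (Fact.out : p.Prime).one_lt
  split_ifs with h
  · rw [h, zero_pow (by omega)]
  · exact ZMod.pow_card_sub_one_eq_one h

theorem pow_card_sub_two (hp : 2 < p) (b : ZMod p) : b ^ (p - 2) = b⁻¹ := by
  by_cases h : b = 0
  · rw [h, zero_pow (by omega), inv_zero]
  · refine eq_inv_of_mul_eq_one_left ?_
    rw [← pow_succ, ← ZMod.pow_card_sub_one_eq_one h]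
    congr 1; omega

theorem pow_card_sub_three (hp : 3 < p) (b : ZMod p) : b ^ (p - 3) = (b ^ 2)⁻¹ := by
  by_cases h : b = 0
  · rw [h, zero_pow (by omega)]; simp
  · refine eq_inv_of_mul_eq_one_left ?_
    rw [← pow_add, ← ZMod.pow_card_sub_one_eq_one h]
    congr 1; omega

theorem homogTwo_card_sub_two (hp : 2 < p) (b c : ZMod p) :
    homogTwo (p - 2) b c = (if c = 0 then b⁻¹ else 0) + (if b = 0 then c⁻¹ else 0)
      - if b = c then b⁻¹ else 0 := by
  by_cases h : b = c
  · subst h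
    have e : ((p - 2 : ℕ) : ZMod p) = -2 := by
      rw [Nat.cast_sub hp.le]; simp
    rw [homogTwo_self, pow_card_sub_two hp, e]
    by_cases hb : b = 0
    · simp [hb]
    · simp [hb]; ring
  · apply mul_left_cancel₀ (sub_ne_zero.2 h)
    rw [sub_mul_homogTwo, show p - 2 + 1 = p - 1 by omega, pow_card_sub_one_eq_ite,
      pow_card_sub_one_eq_ite]
    by_cases hb : b = 0
    · have hc : c ≠ 0 := fun hc => h (hb.trans hc.symm)
      subst hb
      simp [hc, h]
    · by_cases hc : c = 0
      · subst hc; simp [hb]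
      · simp [hb, hc, h]

/-- For distinct arguments, the cyclic sum of `1 / ((b-c)(b-d))` is zero, so only the correction for
a vanishing argument remains. The cyclic form lets `sum_triple_rotate` treat the analogous terms
alike. -/
theorem homogThree_card_sub_three (hp : Odd p) (hp3 : 3 < p) (b c d : ZMod p) :
    homogThree (p - 3) b c d =
      (if b = c then if c = d then (b ^ 2)⁻¹ else 0 else 0)
      + (if b = c then (if b = 0 then (d ^ 2)⁻¹ else 0) - b⁻¹ * (b - d)⁻¹ else 0)
      + (if d = b then (if d = 0 then (c ^ 2)⁻¹ else 0) - d⁻¹ * (d - c)⁻¹ else 0)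
      + (if c = d then (if c = 0 then (b ^ 2)⁻¹ else 0) - c⁻¹ * (c - b)⁻¹ else 0)
      - (if b = 0 then c⁻¹ * d⁻¹ else 0)
      - (if c = 0 then d⁻¹ * b⁻¹ else 0)
      - (if d = 0 then b⁻¹ * c⁻¹ else 0) := by
  have h2 := two_ne_zero_of_odd hp
  have h4 := sub_mul_homogThree (p - 3) b c d
  have h4' := sub_mul_homogThree' (p - 3) b c d
  rw [show p - 3 + 1 = p - 2 by omega, homogTwo_card_sub_two (by omega),
    homogTwo_card_sub_two (by omega)] at h4 h4'
  by_cases hbc : b = c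
  · subst hbc
    by_cases hbd : b = d
    · subst hbd
      have h5 := two_mul_homogThree_self (p - 3) b
      have e : ((p - 3 : ℕ) : ZMod p) = -3 := by
        rw [Nat.cast_sub hp3.le]; simp
      rw [pow_card_sub_three hp3, e] at h5
      apply mul_left_cancel₀ h2
      rw [h5]
      by_cases hb : b = 0
      · simp [hb]
      · simp [hb]; ring
    · apply mul_left_cancel₀ (sub_ne_zero.2 hbd)
      rw [h4']
      have hbd' := sub_ne_zero.2 hbd
      have hdb : ¬ d = b := fun h => hbd h.symm
      by_cases hb : b = 0
      · subst hb; simp [hbd, hdb]; field_simp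
      · by_cases hd : d = 0
        · subst hd; simp [hb, hdb]; field_simp
        · simp [hb, hd, hbd, hdb]; field_simp
  · apply mul_left_cancel₀ (sub_ne_zero.2 hbc)
    rw [h4]
    have hbc' := sub_ne_zero.2 hbc
    have hcb : ¬ c = b := fun h => hbc h.symm
    have hcb' := sub_ne_zero.2 hcb
    by_cases hbd : b = d
    · subst hbd
      by_cases hb : b = 0
      · subst hb; simp [hbc, hcb]; field_simp
      · by_cases hc : c = 0
        · subst hc; simp [hb, hcb]; field_simp
        · simp [hb, hc, hbc, hcb]; field_simp
    · have hdb : ¬ d = b := fun h => hbd h.symm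
      by_cases hcd : c = d
      · subst hcd
        by_cases hb : b = 0
        · subst hb; simp [hbc, hcb]; field_simp; ring
        · by_cases hc : c = 0
          · subst hc; simp [hb, hcb]; field_simp
          · simp [hb, hc, hbc, hcb]; field_simp; ring
      · have hdc : ¬ d = c := fun h => hcd h.symm
        by_cases hb : b = 0
        · subst hb; simp [hbc, hcb, hbd, hdb, hcd]
        · by_cases hc : c = 0
          · subst hc; simp [hbc, hbd, hdb, hcd, hdc]; field_simp
          · by_cases hd : d = 0
            · subst hd; simp [hbc, hbd, hdb, hcd]; field_simp; ring
            · simp [hb, hc, hd, hbc, hbd, hdb, hcd]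

theorem sum_inv_mul_inv_sub (hp : Odd p) (hp3 : 3 < p) (d : ZMod p) :
    ∑ b : ZMod p, b⁻¹ * (b - d)⁻¹ = 2 * (d ^ 2)⁻¹ := by
  by_cases hd : d = 0
  · subst hd
    rw [← mul_zero (0 : ZMod p)]
    simpa [sq] using sum_inv_sq_eq_zero (p := p) hp3
  -- Partial fractions, corrected at the two poles, where `0⁻¹ = 0` makes the left side vanish.
  · have h : ∀ b : ZMod p, b⁻¹ * (b - d)⁻¹ = d⁻¹ * ((b - d)⁻¹ - b⁻¹)
        + (if b = 0 then (d ^ 2)⁻¹ else 0) + (if b = d then (d ^ 2)⁻¹ else 0) := by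
      intro b
      by_cases hb : b = 0
      · subst hb; simp [Ne.symm hd]; field_simp; ring
      · by_cases hbd : b = d
        · subst hbd; simp [hb]; field_simp; ring
        · have := sub_ne_zero.2 hbd
          simp [hb, hbd]; field_simp; ring
    simp_rw [h, Finset.sum_add_distrib, ← Finset.mul_sum, Finset.sum_sub_distrib,
      sum_inv_sub_eq_zero hp, sum_inv_eq_zero hp]
    simp; ring

/-- The sum is `E_(p-2)`, an Euler number of odd index. -/
theorem sum_eulerSign_mul_inv (hp : Odd p) (hp3 : 3 < p) :
    ∑ b : ZMod p, eulerSign p b * b⁻¹ = 0 := by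
  simp_rw [← pow_card_sub_two (show 2 < p by omega)]
  rw [← eulerNumber_cast hp, eulerNumber_of_odd _ (Nat.Odd.sub_even (by omega) hp (by decide)),
    Int.cast_zero]

theorem sum_triple_fst_eq_zero (ε : ZMod p → ZMod p) (h : ∑ b, ε b * b⁻¹ = 0) :
    ∑ b, ∑ c, ∑ d, ε b * ε c * ε d * (if b = 0 then c⁻¹ * d⁻¹ else 0) = 0 := by
  have : ∀ b c : ZMod p, ∑ d, ε b * ε c * ε d * (if b = 0 then c⁻¹ * d⁻¹ else 0) = 0 := by
    intro b c
    split_ifs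
    · rw [← mul_zero (ε b * ε c * c⁻¹), ← h, Finset.mul_sum]
      exact Finset.sum_congr rfl fun d _ => by ring
    · simp
  exact Finset.sum_eq_zero fun b _ => Finset.sum_eq_zero fun c _ => this b c

theorem eulerTripleSum_card_sub_three (hp : Odd p) (hp3 : 3 < p) :
    (eulerTripleSum (p - 3) : ZMod p) = -2 * eulerNumber (p - 3) := by
  have hE := sum_eulerSign_mul_inv hp hp3
  have z1 := sum_triple_fst_eq_zero _ hE
  have z2 : ∑ b, ∑ c, ∑ d, eulerSign p b * eulerSign p c * eulerSign p d *
      (if c = 0 then d⁻¹ * b⁻¹ else 0) = 0 := by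
    refine (sum_triple_rotate _).trans (Eq.trans ?_ z1)
    refine Finset.sum_congr rfl fun b _ => Finset.sum_congr rfl fun c _ =>
      Finset.sum_congr rfl fun d _ => by split_ifs <;> ring
  have z3 : ∑ b, ∑ c, ∑ d, eulerSign p b * eulerSign p c * eulerSign p d *
      (if d = 0 then b⁻¹ * c⁻¹ else 0) = 0 := by
    refine (sum_triple_rotate _).trans (Eq.trans ?_ z2)
    refine Finset.sum_congr rfl fun b _ => Finset.sum_congr rfl fun c _ =>
      Finset.sum_congr rfl fun d _ => by split_ifs <;> ring
  have hf : ∀ d : ZMod p, ∑ b : ZMod p,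
      ((if b = 0 then (d ^ 2)⁻¹ else 0) - b⁻¹ * (b - d)⁻¹) = -(d ^ 2)⁻¹ := by
    intro d
    rw [Finset.sum_sub_distrib, sum_inv_mul_inv_sub hp hp3]
    simp; ring
  simp_rw [eulerTripleSum_cast hp, homogThree_card_sub_three hp hp3, mul_sub _ _ (ite _ _ _),
    mul_add, Finset.sum_sub_distrib, Finset.sum_add_distrib]
  rw [z1, z2, z3, sum_triple_diagonal (eulerSign p) (fun b => (b ^ 2)⁻¹) eulerSign_mul_self,
    sum_triple_eq_fst_snd (eulerSign p) (fun b d => (if b = 0 then (d ^ 2)⁻¹ else 0) - b⁻¹ * (b - d)⁻¹)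
      eulerSign_mul_self,
    sum_triple_eq_thd_fst (eulerSign p) (fun b d => (if b = 0 then (d ^ 2)⁻¹ else 0) - b⁻¹ * (b - d)⁻¹)
      eulerSign_mul_self,
    sum_triple_eq_snd_thd (eulerSign p) (fun b d => (if b = 0 then (d ^ 2)⁻¹ else 0) - b⁻¹ * (b - d)⁻¹)
      eulerSign_mul_self]
  simp_rw [hf, mul_neg, Finset.sum_neg_distrib, eulerNumber_cast hp, pow_card_sub_three hp3]
  ring

end Prime

/-! ### Uniqueness of `t(n)`, small values and the conclusion -/

theorem int_eq_of_modEq_primes {a b : ℤ} (N : ℕ)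
    (h : ∀ p : ℕ, p.Prime → N < p → a ≡ b [ZMOD (p : ℤ)]) : a = b := by
  obtain ⟨p, hp, hpp⟩ := Nat.exists_infinite_primes (N + (b - a).natAbs + 1)
  have hd := (h p hpp (by omega)).dvd
  have := Int.eq_zero_of_abs_lt_dvd hd (by rw [Int.abs_eq_natAbs]; omega)
  omega

theorem eulerNumber_two : eulerNumber 2 = -1 := by
  have := sum_choose_mul_eulerNumber 2 (by norm_num)
  simp [Finset.sum_filter, Finset.sum_range_succ, eulerNumber_zero, Nat.even_iff] at this
  linarith

theorem eulerNumber_four : eulerNumber 4 = 5 := by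
  have := sum_choose_mul_eulerNumber 4 (by norm_num)
  simp [Finset.sum_filter, Finset.sum_range_succ, eulerNumber_zero, eulerNumber_two,
    Nat.even_iff, Nat.choose] at this
  linarith

theorem eulerNumber_six : eulerNumber 6 = -61 := by
  have := sum_choose_mul_eulerNumber 6 (by norm_num)
  simp [Finset.sum_filter, Finset.sum_range_succ, eulerNumber_zero, eulerNumber_two,
    eulerNumber_four, Nat.even_iff, Nat.choose] at this
  linarith

theorem theorem1p2 :
    (∀ p : ℕ, p.Prime → Odd p →
      eulerTripleSum (p - 3) ≡ -2 * eulerNumber (p - 3) [ZMOD (p : ℤ)]) ∧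
    ∃ t : ℕ → ℤ,
      (∀ n : ℕ,
        (∀ p : ℕ, p.Prime → Odd p → 2 * n + 1 < p →
          eulerTripleSum (p - 1 + 2 * n) ≡ t n [ZMOD (p : ℤ)]) ∧
        (∀ u : ℤ,
          (∀ p : ℕ, p.Prime → Odd p → 2 * n + 1 < p →
            eulerTripleSum (p - 1 + 2 * n) ≡ u [ZMOD (p : ℤ)]) →
          u = t n)) ∧
      t 0 = 3 ∧ t 1 = -9 ∧ t 2 = 68 ∧ t 3 = -1068 := by
  have key : ∀ n p : ℕ, p.Prime → Odd p → 2 * n + 1 < p →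
      eulerTripleSum (p - 1 + 2 * n) ≡
        eulerTripleSum (2 * n) + 2 * (2 * n + 1) * eulerNumber (2 * n) [ZMOD (p : ℤ)] := by
    intro n p hp hodd hn
    have : Fact p.Prime := ⟨hp⟩
    rw [← ZMod.intCast_eq_intCast_iff, add_comm (p - 1)]
    simpa using eulerTripleSum_add_card_sub_one hodd (show 2 * n < p - 1 by omega)
  have e1 := eulerNumber_of_odd 1 (by decide)
  have e3 := eulerNumber_of_odd 3 (by decide)
  have e5 := eulerNumber_of_odd 5 (by decide)
  refine ⟨fun p hp hodd => ?_,
    fun n => eulerTripleSum (2 * n) + 2 * (2 * n + 1) * eulerNumber (2 * n),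
    fun n => ⟨key n, fun u hu => ?_⟩, ?_, ?_, ?_, ?_⟩
  · have : Fact p.Prime := ⟨hp⟩
    rcases Nat.lt_or_ge 3 p with h | h
    · rw [← ZMod.intCast_eq_intCast_iff]
      simpa using eulerTripleSum_card_sub_three hodd h
    · have : p = 3 := by
        have := hp.two_le
        obtain ⟨k, rfl⟩ := hodd
        omega
      subst this
      -- For `p = 3` the claim is `1 ≡ -2` modulo `3`.
      simp [eulerTripleSum, eulerNumber_zero, Int.ModEq]
  · refine int_eq_of_modEq_primes (2 * n + 2) fun p hp hn => ?_
    have hodd : Odd p := hp.odd_of_ne_two (by omega)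
    exact (hu p hp hodd (by omega)).symm.trans (key n p hp hodd (by omega))
  all_goals
    simp [eulerTripleSum, Finset.Nat.antidiagonal_succ, eulerNumber_zero, e1, e3, e5,
      eulerNumber_two, eulerNumber_four, eulerNumber_six]
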